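/- An $\omega$-Lie algebra over $\mathbb{C}$ is a complex vector space $L$ with a skew-symmetric bilinear bracket $[-,-]:L\times L\to L$ and a skew-symmetric bilinear form $\omega:L\times L\to\mathbb{C}$ such that $$[[x,y],z]+[[y,z],x]+[[z,x],y]=\omega(x,y)z+\omega(y,z)x+\omega(z,x)y\quad\text{for all }x,y,z\in L;$$ it is called non-Lie if $[-,-]$ does not satisfy the Jacobi identity. Let $L$ be a $4$-dimensional non-Lie $\omega$-Lie algebra over $\mathbb{C}$. Then there exists a linear map $R:L\to L$ with $R^2=0$ that is a Rota-Baxter operator of weight $0$, i.e. $[R(x),R(y)]=R([R(x),y]+[x,R(y)])$ for all $x,y\in L$, and is compatible, i.e. $\omega(R(x),y)+\omega(x,R(y))=0$ for all $x,y\in L$, and such that the induced Hom-Lie algebra $\mathfrak{g}=(L,[-,-]_R,R)$, where $[x,y]_R:=[R(x),y]+[x,R(y)]$, is nonabelian and solvable. Here a Hom-Lie algebra is a vector space with a skew-symmetric bilinear bracket $[-,-]$ and a linear map $\alpha$ such that $[[x,y],\alpha(z)]+[[y,z],\alpha(x)]+[[z,x],\alpha(y)]=0$ for all $x,y,z$ (for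 $\mathfrak{g}$, $\alpha=R$). It is nonabelian if its bracket is not identically zero, and solvable if its derived series $\mathfrak{g}^{(0)}=\mathfrak{g}$, $\mathfrak{g}^{(k+1)}=[\mathfrak{g}^{(k)},\mathfrak{g}^{(k)}]$ (linear span of brackets) satisfies $\mathfrak{g}^{(k)}=0$ for some $k$. -/

import Mathlib

/-- An omega-Lie algebra structure on the `K`-vector space `L`: a skew-symmetric bilinear bracket
and a skew-symmetric bilinear form `omega` related by the omega-Jacobi identity.
(It is used over fields of characteristic different from 2.) -/
structure OmegaLieAlgebra (K L : Type*) [Field K] [AddCommGroup L] [Module K L] where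
  bracket : L →ₗ[K] L →ₗ[K] L
  omega : L →ₗ[K] L →ₗ[K] K
  bracket_skew : ∀ x y, bracket x y = -bracket y x
  omega_skew : ∀ x y, omega x y = -omega y x
  omega_jacobi : ∀ x y z,
    bracket (bracket x y) z + bracket (bracket y z) x + bracket (bracket z x) y =
      omega x y • z + omega y z • x + omega z x • y

/-- A Hom-Lie algebra structure on the `K`-vector space `L`: a skew-symmetric bilinear bracket and
a linear map `alpha` satisfying the Hom-Jacobi identity. -/
structure HomLieAlgebra (K L : Type*) [Field K] [AddCommGroup L] [Module K L] where
  bracket : L →ₗ[K] L →ₗ[K] L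
  alpha : L →ₗ[K] L
  bracket_skew : ∀ x y, bracket x y = -bracket y x
  hom_jacobi : ∀ x y z,
    bracket (bracket x y) (alpha z) + bracket (bracket y z) (alpha x)
      + bracket (bracket z x) (alpha y) = 0

namespace HomLieAlgebra

variable {K L : Type*} [Field K] [AddCommGroup L] [Module K L]

/-- The Hom-Lie algebra is abelian: its bracket vanishes identically. -/
def IsAbelian (g : HomLieAlgebra K L) : Prop := ∀ x y, g.bracket x y = 0

/-- The derived series `g⁽⁰⁾ = g`, `g⁽ᵏ⁺¹⁾ = [g⁽ᵏ⁾, g⁽ᵏ⁾]`, where the bracket of two subspaces is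
the linear span of all brackets of their elements. -/
def derivedSeries (g : HomLieAlgebra K L) : ℕ → Submodule K L
  | 0 => ⊤
  | k + 1 => Submodule.span K
      {v | ∃ x ∈ derivedSeries g k, ∃ y ∈ derivedSeries g k, g.bracket x y = v}

/-- The Hom-Lie algebra is solvable: its derived series reaches zero. -/
def IsSolvable (g : HomLieAlgebra K L) : Prop := ∃ k, g.derivedSeries k = ⊥

end HomLieAlgebra

namespace OmegaLieAlgebra

variable {K L : Type*} [Field K] [AddCommGroup L] [Module K L]

/-- The bracket satisfies the ordinary Jacobi identity, so that it is a Lie bracket. -/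
def IsLie (A : OmegaLieAlgebra K L) : Prop :=
  ∀ x y z, A.bracket (A.bracket x y) z + A.bracket (A.bracket y z) x
    + A.bracket (A.bracket z x) y = 0

/-- `R` is a Rota-Baxter operator of weight `c`. -/
def IsRotaBaxter (A : OmegaLieAlgebra K L) (c : K) (R : L →ₗ[K] L) : Prop :=
  ∀ x y, A.bracket (R x) (R y) = R (A.bracket (R x) y + A.bracket x (R y) + c • A.bracket x y)

/-- `R` is compatible with the form `omega`. -/
def IsCompatible (A : OmegaLieAlgebra K L) (R : L →ₗ[K] L) : Prop :=
  ∀ x y, A.omega (R x) y + A.omega x (R y) = 0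

/-- The bilinear bracket `[x, y]_R = [R x, y] + [x, R y]`. -/
def inducedBracket (A : OmegaLieAlgebra K L) (R : L →ₗ[K] L) : L →ₗ[K] L →ₗ[K] L :=
  A.bracket.comp R + A.bracket.compl₂ R

theorem inducedBracket_apply (A : OmegaLieAlgebra K L) (R : L →ₗ[K] L) (x y : L) :
    A.inducedBracket R x y = A.bracket (R x) y + A.bracket x (R y) := rfl

/-- The Hom-Lie algebra `(L, [-,-]_R, R)` induced by a compatible Rota-Baxter operator `R` of
weight `0` with `R² = 0`. -/
def inducedHomLie (A : OmegaLieAlgebra K L) (R : L →ₗ[K] L) (hR : A.IsRotaBaxter 0 R)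
    (hc : A.IsCompatible R) (hsq : R ∘ₗ R = 0) : HomLieAlgebra K L where
  bracket := A.inducedBracket R
  alpha := R
  bracket_skew x y := by
    rw [inducedBracket_apply, inducedBracket_apply, A.bracket_skew (R x) y,
      A.bracket_skew x (R y)]
    abel
  hom_jacobi x y z := by
    have hRR : ∀ x, R (R x) = 0 := fun x => LinearMap.congr_fun hsq x
    have hb : ∀ x y, R (A.inducedBracket R x y) = A.bracket (R x) (R y) := fun x y => by
      rw [hR x y, inducedBracket_apply, zero_smul, add_zero]
    have hw : ∀ x y, A.omega (R x) (R y) = 0 := fun x y => by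
      have h := hc x (R y)
      rwa [hRR, map_zero, add_zero] at h
    have key : ∀ x y z, A.inducedBracket R (A.inducedBracket R x y) (R z) =
        A.bracket (A.bracket (R x) (R y)) (R z) := fun x y z => by
      rw [inducedBracket_apply A R (A.inducedBracket R x y) (R z), hb, hRR, map_zero, add_zero]
    rw [key, key, key, A.omega_jacobi, hw, hw, hw]
    simp

end OmegaLieAlgebra

namespace OmegaLieAlgebra

variable {K L : Type*} [Field K] [AddCommGroup L] [Module K L]

/-! An operator of rank one suffices: `R = f(·) v`, with `v` in the radical of `ω` and `f` a left
eigenvector of `ad v` with `f v = 0`. Compatibility and `R² = 0` are then immediate, and both sides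
of the Rota-Baxter identity vanish. Since `[x, y]_R = f x • [v, y] - f y • [v, x]`, the derived
algebra lies in `ker f`, where the bracket is zero; the bracket is nonzero once `ad v` does not
vanish on `ker f`. Such a `v` exists because in dimension four the trace of `ad` makes `ω` a
coboundary, which forces `ω ∧ ω = 0`. Linear algebra over an algebraically closed field supplies
`f`. -/

theorem bracket_bracket_eq (A : OmegaLieAlgebra K L) (x y : L) :
    A.bracket (A.bracket x y) = A.bracket x * A.bracket y - A.bracket y * A.bracket x
      + A.omega x y • LinearMap.id + (A.omega y).smulRight x - (A.omega x).smulRight y := by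
  ext z
  have h := A.omega_jacobi x y z
  rw [A.bracket_skew (A.bracket y z) x, A.bracket_skew (A.bracket z x) y, A.bracket_skew z x,
    A.omega_skew z x, map_neg, neg_neg, neg_smul] at h
  simp only [LinearMap.add_apply, LinearMap.sub_apply, Module.End.mul_apply,
    LinearMap.smul_apply, LinearMap.id_apply, LinearMap.smulRight_apply]
  rw [← sub_eq_zero] at h ⊢
  rw [← h]
  module

/-- The commutator is traceless, the identity contributes the dimension, and the two rank-one terms
contribute `-2 ω(x, y)`. -/
theorem trace_bracket_bracket [FiniteDimensional K L] (A : OmegaLieAlgebra K L) (x y : L) :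
    LinearMap.trace K L (A.bracket (A.bracket x y))
      = ((Module.finrank K L : K) - 2) * A.omega x y := by
  rw [bracket_bracket_eq]
  simp only [map_add, map_sub, map_smul, LinearMap.trace_smulRight, LinearMap.trace_id,
    LinearMap.trace_mul_comm K (A.bracket x), smul_eq_mul]
  rw [A.omega_skew y x]
  ring

/-- If `ω` is the coboundary of a linear form `τ`, normalised as the trace of the adjoint
representation is in dimension four, then `ω ∧ ω = 0`. -/
theorem omega_wedge_omega_eq_zero [CharZero K] (A : OmegaLieAlgebra K L) (τ : L →ₗ[K] K)
    (hτ : ∀ x y, τ (A.bracket x y) = 2 * A.omega x y) (x y z t : L) :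
    A.omega x y * A.omega z t - A.omega x z * A.omega y t + A.omega x t * A.omega y z = 0 := by
  -- With `ω` a coboundary of `τ`, applying `τ` to the ω-Jacobi identity relates `dω` to `ω ∧ τ`.
  have d (x y z : L) : 2 * (A.omega (A.bracket x y) z + A.omega (A.bracket y z) x
      + A.omega (A.bracket z x) y)
      = A.omega x y * τ z + A.omega y z * τ x + A.omega z x * τ y := by
    have h := congrArg τ (A.omega_jacobi x y z)
    simp only [map_add, map_smul, hτ, smul_eq_mul] at h
    linear_combination h
  have j (x y z t : L) : A.omega (A.bracket (A.bracket x y) z) t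
      + A.omega (A.bracket (A.bracket y z) x) t + A.omega (A.bracket (A.bracket z x) y) t
      = A.omega x y * A.omega z t + A.omega y z * A.omega x t + A.omega z x * A.omega y t := by
    have h := congrArg (fun u => A.omega u t) (A.omega_jacobi x y z)
    simpa only [map_add, map_smul, LinearMap.add_apply, LinearMap.smul_apply, smul_eq_mul] using h
  have e (x y z t : L) : 2 * (A.omega (A.bracket (A.bracket x y) z) t
      + A.omega (A.bracket z t) (A.bracket x y) - A.omega (A.bracket (A.bracket x y) t) z)
      = A.omega (A.bracket x y) z * τ t + 2 * A.omega z t * A.omega x y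
        - A.omega (A.bracket x y) t * τ z := by
    have h := d (A.bracket x y) z t
    rw [A.bracket_skew t, A.omega_skew t, hτ, map_neg, LinearMap.neg_apply] at h
    linear_combination h
  -- Over the six pairs, the terms `ω([x, y], [z, t])` cancel by skewness, `j` removes the double
  -- brackets and `d` the terms linear in `τ`, as `ω ∧ τ ∧ τ = 0`. What is left is a nonzero
  -- multiple of `ω ∧ ω`.
  have h₁ := e x y z t
  have h₂ := e y z x t
  have h₃ := e x z y t
  have h₄ := e z t x y
  have h₅ := e x t y z
  have h₆ := e y t x z
  have j₁ := j x y z t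
  have j₂ := j x y t z
  have j₃ := j y z t x
  have j₄ := j x z t y
  have d₁ := d x y z
  have d₂ := d x y t
  have d₃ := d y z t
  have d₄ := d x z t
  simp only [A.bracket_skew z x, A.bracket_skew t x, A.bracket_skew t y, A.omega_skew y x, A.omega_skew z x, A.omega_skew t x,
    A.omega_skew z y, A.omega_skew t y, A.omega_skew t z,
    A.omega_skew (A.bracket z t) (A.bracket x y), A.omega_skew (A.bracket y t) (A.bracket x z),
    A.omega_skew (A.bracket x t) (A.bracket y z), map_neg, LinearMap.neg_apply]
    at h₁ h₂ h₃ h₄ h₅ h₆ j₁ j₂ j₃ j₄ d₁ d₂ d₃ d₄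
  linear_combination (h₁ + h₂ - h₃ + h₄ + h₅ - h₆) / 4 - (j₁ - j₂ - j₃ + j₄) / 2
    + (d₁ * τ t - d₂ * τ z - d₃ * τ x + d₄ * τ y) / 8

theorem exists_mem_radical (hdim : 2 < Module.finrank K L) (A : OmegaLieAlgebra K L)
    (hA : ¬ A.IsLie)
    (hω : ∀ x y z t, A.omega x y * A.omega z t - A.omega x z * A.omega y t
      + A.omega x t * A.omega y z = 0) :
    ∃ v, v ≠ 0 ∧ A.omega v = 0 ∧ A.bracket v ≠ 0 := by
  have : FiniteDimensional K L := FiniteDimensional.of_finrank_pos (by omega)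
  obtain ⟨x, y, hxy⟩ : ∃ x y, A.omega x y ≠ 0 := by
    by_contra! h
    exact hA fun x y z => by simp [A.omega_jacobi, h]
  -- As `ω(x, y) ≠ 0`, the relation `ω ∧ ω = 0` puts every vector orthogonal to `x` and `y` in the
  -- radical.
  obtain ⟨v, hv, hv0⟩ := (Submodule.ne_bot_iff _).1
    (LinearMap.ker_ne_bot_of_finrank_lt (f := (A.omega x).prod (A.omega y)) (by simpa using hdim))
  simp only [LinearMap.mem_ker, LinearMap.prod_apply, Function.prod, Prod.mk_eq_zero] at hv
  have hrad : A.omega v = 0 := by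
    ext t
    have := hω x y v t
    simpa [hv.1, hv.2, hxy] using this
  -- If `ad v = 0`, the ω-Jacobi identity on `x, y, v` reduces to `ω(x, y) v = 0`.
  refine ⟨v, hv0, hrad, fun hb => hxy ?_⟩
  have h := A.omega_jacobi x y v
  rw [A.bracket_skew (A.bracket x y) v, A.bracket_skew y v, A.omega_skew y v] at h
  have h' : A.omega x y • v = 0 := by simpa [hb, hrad, hv.2] using h.symm
  exact (smul_eq_zero.1 h').resolve_right hv0

end OmegaLieAlgebra

/-- A nonzero endomorphism with a nonzero kernel vector `v` has a left eigenvector `f` killing `v`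
such that the endomorphism is not a multiple of `f`. -/
theorem Module.End.exists_dual_eigenvector {K L : Type*} [Field K] [IsAlgClosed K]
    [AddCommGroup L] [Module K L] (hdim : 3 < Module.finrank K L) (D : Module.End K L) (hD : D ≠ 0)
    (v : L) (hv : D v = 0) :
    ∃ (f : L →ₗ[K] K) (c : K), f ≠ 0 ∧ f v = 0 ∧ (∀ x, f (D x) = c * f x) ∧
      ∃ u, f u = 0 ∧ D u ≠ 0 := by
  have : FiniteDimensional K L := FiniteDimensional.of_finrank_pos (by omega)
  set N := K ∙ v
  have hN : N ≤ N.comap D := by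
    rw [Submodule.span_singleton_le_iff_mem]; simp [hv]
  have hlt : Module.finrank K N < Module.finrank K L :=
    (finrank_span_le_card ({v} : Set L)).trans_lt (by simp; omega)
  have : Nontrivial (L ⧸ N) := Submodule.Quotient.nontrivial_iff.2 fun h => by
    rw [h, finrank_top] at hlt; exact hlt.false
  -- Passing to the quotient by `v` before dualising makes the eigenvector kill `v`.
  obtain ⟨c, hc⟩ := Module.End.exists_eigenvalue (N.mapQ N D hN).dualMap
  obtain ⟨g, hg⟩ := hc.exists_hasEigenvector
  have hgD (x : L) : g (N.mkQ (D x)) = c * g (N.mkQ x) := by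
    simpa using LinearMap.congr_fun hg.apply_eq_smul (N.mkQ x)
  have hgv : g (N.mkQ v) = 0 := by
    rw [Submodule.mkQ_apply, (Submodule.Quotient.mk_eq_zero N).2 (Submodule.mem_span_singleton_self v),
      map_zero]
  by_cases hu : ∃ u, g (N.mkQ u) = 0 ∧ D u ≠ 0
  · refine ⟨g ∘ₗ N.mkQ, c, fun h => hg.2 (LinearMap.ext fun q => ?_), hgv, hgD, hu⟩
    obtain ⟨x, rfl⟩ := N.mkQ_surjective q
    exact LinearMap.congr_fun h x
  -- Otherwise `D` vanishes on the kernel of this form, so it has rank one with image spanned by `D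
  -- p`. Any nonzero form killing `v`, `p` and `D p` then works with eigenvalue `0`; it exists
  -- because the dimension exceeds three.
  · push Not at hu
    obtain ⟨p, hp⟩ : ∃ p, D p ≠ 0 := by
      by_contra! h
      exact hD (LinearMap.ext h)
    have hgp : g (N.mkQ p) ≠ 0 := fun h => hp (hu p h)
    have hDx (x : L) : D x = (g (N.mkQ x) / g (N.mkQ p)) • D p := by
      rw [← sub_eq_zero, ← map_smul, ← map_sub]
      apply hu
      simp only [map_sub, map_smul, smul_eq_mul]
      field_simp
      ring
    obtain ⟨f, hf0, hf⟩ := Submodule.exists_le_ker_of_lt_top (Submodule.span K {v, p, D p}) <|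
      lt_top_iff_ne_top.2 fun h => by
        classical
        have h3 := finrank_span_finset_le_card (R := K) ({v, p, D p} : Finset L)
        have h4 : ({v, p, D p} : Finset L).card ≤ 3 := Finset.card_le_three
        rw [Finset.coe_insert, Finset.coe_insert, Finset.coe_singleton, Set.finrank, h,
          finrank_top] at h3
        omega
    have hf' : ∀ x ∈ ({v, p, D p} : Set L), f x = 0 := fun x hx => hf (Submodule.subset_span hx)
    refine ⟨f, 0, hf0, hf' v (by simp), fun x => ?_, p, hf' p (by simp), hp⟩
    rw [hDx x, map_smul, hf' (D p) (by simp), smul_zero, zero_mul]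

theorem corollary4p7 {L : Type*} [AddCommGroup L] [Module ℂ L]
    (hdim : Module.finrank ℂ L = 4) (A : OmegaLieAlgebra ℂ L) (hA : ¬ A.IsLie) :
    ∃ (R : L →ₗ[ℂ] L) (hR : A.IsRotaBaxter 0 R) (hc : A.IsCompatible R) (hsq : R ∘ₗ R = 0),
      ¬ (A.inducedHomLie R hR hc hsq).IsAbelian ∧
        (A.inducedHomLie R hR hc hsq).IsSolvable := by
  have : FiniteDimensional ℂ L := FiniteDimensional.of_finrank_pos (by omega)
  have hω := A.omega_wedge_omega_eq_zero (LinearMap.trace ℂ L ∘ₗ A.bracket) fun x y => by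
    rw [LinearMap.comp_apply, A.trace_bracket_bracket, hdim]; norm_num
  obtain ⟨v, -, hrad, hb⟩ := A.exists_mem_radical (by omega) hA hω
  -- Torsion-freeness turns `[v, v] = -[v, v]` into `[v, v] = 0`.
  have : Module ℚ L := Module.compHom L (algebraMap ℚ ℂ)
  have := IsAddTorsionFree.of_module_rat L
  have hself : A.bracket v v = 0 := self_eq_neg.1 (A.bracket_skew v v)
  obtain ⟨f, c, hf0, hfv, hfD, u, hfu, hDu⟩ :=
    Module.End.exists_dual_eigenvector (by omega) (A.bracket v) hb v hself
  have hrad' (x : L) : A.omega x v = 0 := by rw [A.omega_skew, hrad]; simp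
  have hR : A.IsRotaBaxter 0 (f.smulRight v) := fun x y => by
    rw [A.bracket_skew x]
    simp only [LinearMap.smulRight_apply, map_smul, LinearMap.smul_apply, hself, smul_zero,
      zero_smul, add_zero, map_add, map_neg, hfD]
    module
  have hc : A.IsCompatible (f.smulRight v) := fun x y => by simp [hrad, hrad']
  have hsq : f.smulRight v ∘ₗ f.smulRight v = 0 := by ext x; simp [hfv]
  have hbr (x y : L) : (A.inducedHomLie _ hR hc hsq).bracket x y
      = f x • A.bracket v y - f y • A.bracket v x := by
    change A.bracket (f x • v) y + A.bracket x (f y • v) = _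
    rw [map_smul, map_smul, LinearMap.smul_apply, A.bracket_skew x v, smul_neg, sub_eq_add_neg]
  refine ⟨f.smulRight v, hR, hc, hsq, fun hab => ?_, 2, ?_⟩
  · obtain ⟨p, hp⟩ : ∃ p, f p ≠ 0 := by
      by_contra! h
      exact hf0 (LinearMap.ext h)
    -- Here `[p, u]_R = f p • [v, u]`, with both factors nonzero.
    have h := hab p u
    rw [hbr, hfu, zero_smul, sub_zero] at h
    exact (smul_ne_zero hp hDu) h
  · have h1 : (A.inducedHomLie _ hR hc hsq).derivedSeries 1 ≤ LinearMap.ker f := by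
      refine Submodule.span_le.2 ?_
      rintro _ ⟨x, -, y, -, rfl⟩
      rw [hbr, SetLike.mem_coe, LinearMap.mem_ker, map_sub, map_smul, map_smul, hfD, hfD,
        smul_eq_mul, smul_eq_mul]
      ring
    refine Submodule.span_eq_bot.2 ?_
    rintro _ ⟨x, hx, y, hy, rfl⟩
    rw [hbr, LinearMap.mem_ker.1 (h1 hx), LinearMap.mem_ker.1 (h1 hy)]
    simp
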